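/- Let $N\ge 1$ and let $D\subset\mathbb R^N$ be a bounded domain with smooth boundary. Let $0<p<1$, $a\in\mathbb R$, $0<\alpha<1$, and let $h,r\in C^{0,\alpha}(\overline D)$ satisfy $h\ge 0$ and $r\ge 0$ in $D$. Let $u_1,u_2\in H^1(D)$ be functions that are continuous and positive in $D$, and let $f:[0,\infty)\to\mathbb R$ be a continuous function such that $t\mapsto f(t)/t^p$ is nondecreasing on the open interval $\inf_D\min(u_1,u_2)<t<\sup_D\max(u_1,u_2)$ (where the supremum may be $+\infty$). Suppose that, in the sense of distributions in $D$, $$\Delta u_1+a\,u_1^p-h(x)f(u_1)+r(x)\;\le\;0\;\le\;\Delta u_2+a\,u_2^p-h(x)f(u_2)+r(x),$$ and that $$\limsup_{x\to\partial D}\,\bigl(u_2(x)-u_1(x)\bigr)\le 0 .$$ Then $u_1\ge u_2$ in $D$. -/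

import Mathlib

open MeasureTheory Set Filter Topology TopologicalSpace
open scoped NNReal Distributions InnerProductSpace ContDiff Laplacian

/-- The open set `D ⊆ ℝᴺ` has smooth boundary: near each boundary point, `D` is the sublevel set
`{φ < 0}` of a smooth function `φ` without critical points there (so `D` lies locally on one side
of the smooth hypersurface `{φ = 0}`). -/
def HasSmoothBoundary {N : ℕ} (D : Opens (EuclideanSpace ℝ (Fin N))) : Prop :=
  ∀ z ∈ frontier (D : Set (EuclideanSpace ℝ (Fin N))),
    ∃ U : Set (EuclideanSpace ℝ (Fin N)), IsOpen U ∧ z ∈ U ∧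
      ∃ φ : EuclideanSpace ℝ (Fin N) → ℝ, ContDiffOn ℝ ∞ φ U ∧
        (∀ x ∈ U, fderiv ℝ φ x ≠ 0) ∧
        ∀ x ∈ U, (x ∈ D ↔ φ x < 0)

/-- `h ∈ C^{0,α}(D̄)`: `h` is Hölder continuous with exponent `α` on the closure of `D`. -/
def IsHolderOnClosure {N : ℕ} (D : Opens (EuclideanSpace ℝ (Fin N))) (α : ℝ≥0)
    (h : EuclideanSpace ℝ (Fin N) → ℝ) : Prop :=
  ∃ C : ℝ≥0, HolderOnWith C α h (closure (D : Set (EuclideanSpace ℝ (Fin N))))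

/-- `g` is the weak gradient of `u` in `D`: `∫_D u ∂_v ψ = - ∫_D ⟨g, v⟩ ψ` for every test function
`ψ ∈ C_c^∞(D)` and every direction `v`. -/
def IsWeakGradient {N : ℕ} (D : Opens (EuclideanSpace ℝ (Fin N)))
    (u : EuclideanSpace ℝ (Fin N) → ℝ)
    (g : EuclideanSpace ℝ (Fin N) → EuclideanSpace ℝ (Fin N)) : Prop :=
  ∀ (ψ : 𝓓(D, ℝ)) (v : EuclideanSpace ℝ (Fin N)),
    ∫ x in (D : Set (EuclideanSpace ℝ (Fin N))), u x * fderiv ℝ ψ x v =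
      -∫ x in (D : Set (EuclideanSpace ℝ (Fin N))), ⟪g x, v⟫_ℝ * ψ x

/-- The Sobolev space `H¹(D)`: `u ∈ L²(D)` with a weak gradient in `L²(D)`. -/
def MemH1 {N : ℕ} (D : Opens (EuclideanSpace ℝ (Fin N)))
    (u : EuclideanSpace ℝ (Fin N) → ℝ) : Prop :=
  MemLp u 2 (volume.restrict (D : Set (EuclideanSpace ℝ (Fin N)))) ∧
    ∃ g : EuclideanSpace ℝ (Fin N) → EuclideanSpace ℝ (Fin N),
      MemLp g 2 (volume.restrict (D : Set (EuclideanSpace ℝ (Fin N)))) ∧ IsWeakGradient D u g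

/-- The value of the distribution `Δu + F ∈ 𝓓'(D)` at the test function `ψ`, that is
`∫_D (u Δψ + F ψ)` (for `u`, `F` locally integrable in `D`). -/
noncomputable def laplacianAddPairing {N : ℕ} (D : Opens (EuclideanSpace ℝ (Fin N)))
    (u F : EuclideanSpace ℝ (Fin N) → ℝ) (ψ : 𝓓(D, ℝ)) : ℝ :=
  ∫ x in (D : Set (EuclideanSpace ℝ (Fin N))), (u x * (Δ (ψ : EuclideanSpace ℝ (Fin N) → ℝ)) x +
    F x * ψ x)

/-- `Δu + F ≤ 0` in `𝓓'(D)`. -/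
def LaplacianAddNonpos {N : ℕ} (D : Opens (EuclideanSpace ℝ (Fin N)))
    (u F : EuclideanSpace ℝ (Fin N) → ℝ) : Prop :=
  ∀ ψ : 𝓓(D, ℝ), (∀ x, 0 ≤ ψ x) → laplacianAddPairing D u F ψ ≤ 0

/-- `0 ≤ Δu + F` in `𝓓'(D)`. -/
def LaplacianAddNonneg {N : ℕ} (D : Opens (EuclideanSpace ℝ (Fin N)))
    (u F : EuclideanSpace ℝ (Fin N) → ℝ) : Prop :=
  ∀ ψ : 𝓓(D, ℝ), (∀ x, 0 ≤ ψ x) → 0 ≤ laplacianAddPairing D u F ψ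

/-- The filter `x → ∂D`, `x ∈ D`. -/
def toBoundary {N : ℕ} (D : Opens (EuclideanSpace ℝ (Fin N))) :
    Filter (EuclideanSpace ℝ (Fin N)) :=
  𝓝ˢ (frontier (D : Set (EuclideanSpace ℝ (Fin N)))) ⊓ 𝓟 (D : Set (EuclideanSpace ℝ (Fin N)))

/-- The open interval of all reals `t` with `inf_D (u₁, u₂) < t < sup_D (u₁, u₂)`; infimum and
supremum are taken in the extended reals, as the functions may be unbounded. -/
def valueInterval {N : ℕ} (D : Opens (EuclideanSpace ℝ (Fin N)))
    (u₁ u₂ : EuclideanSpace ℝ (Fin N) → ℝ) : Set ℝ :=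
  {t : ℝ | (⨅ x ∈ D, ((min (u₁ x) (u₂ x) : ℝ) : EReal)) < (t : EReal) ∧
    (t : EReal) < ⨆ x ∈ D, ((max (u₁ x) (u₂ x) : ℝ) : EReal)}

/-!
The function `w = u ^ (1 - p)` turns `Δu + F` into `Δw + c |∇w|² / w + (1 - p) F / u ^ p`, up to the
positive factor `(1 - p) u ^ (-p)`, where `c = p / (1 - p)`; and `F / u ^ p`, with
`F = a u ^ p - h f(u) + r`, is nonincreasing in `u`. If `u₂ > u₁` somewhere, then
`W = u₂ ^ (1 - p) - u₁ ^ (1 - p)` has a positive value; since `t ↦ t ^ (1 - p)` is subadditive, the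
boundary condition makes the superlevel sets `{W ≥ ε}` relatively compact in `D`, even though
`u₁` and `u₂` may tend to `0` or be unbounded near `∂D`. For a small `η > 0` the function `W + η |x|²`
then has an interior maximum point at which `W > 0`. There `∇W = -2 η x` and `ΔW ≤ -2 η N`, and,
as `(ξ, w) ↦ |ξ|² / w` is convex and homogeneous of degree one (`sq_div_sub_sq_div_le`), the
gradient terms contribute at most `c |∇W|² / W = O(η²)`, while the zeroth-order terms have the right
sign. This is impossible for small `η`.

The functions are not differentiable, so the pointwise argument is run on mollifications.
Testing with a translated kernel turns the distributional inequalities into pointwise ones for the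
mollified functions (`exists_laplacianAddPairing_eq_convolution`), to which the inequality at a
maximum point applies (`laplacian_div_sub_le_of_isLocalMax`). As the kernels shrink, the maximum
points accumulate at a maximum point of the limit function, where everything converges by continuity
(`tendsto_convolution_indicator`).
-/

/-! ### Necessary conditions at a maximum point -/

/-- The second-order necessary condition for a local maximum in one variable. -/
theorem IsLocalMax.hasDerivAt_hasDerivAt_nonpos {f f' : ℝ → ℝ} {x f'' : ℝ}
    (hmax : IsLocalMax f x) (hf : ∀ᶠ y in 𝓝 x, HasDerivAt f (f' y) y)
    (hf' : HasDerivAt f' f'' x) : f'' ≤ 0 := by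
  by_contra! hpos
  -- A positive second derivative also gives a local minimum, so `f` is locally constant.
  have hderiv : deriv f =ᶠ[𝓝 x] f' := hf.mono fun y hy => hy.deriv
  have hd2 : deriv (deriv f) x = f'' := by rw [hderiv.deriv_eq, hf'.deriv]
  have hmin : IsLocalMin f x :=
    isLocalMin_of_deriv_deriv_pos (hd2 ▸ hpos) hmax.deriv_eq_zero hf.self_of_nhds.continuousAt
  have hconst : f =ᶠ[𝓝 x] fun _ => f x := by
    filter_upwards [hmax, hmin] with y h1 h2 using le_antisymm h1 h2
  have : deriv (deriv f) x = 0 := by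
    rw [hconst.deriv.deriv_eq]
    simp
  linarith

/-- Subadditivity of `(ξ, w) ↦ ξ² / w`, with `Y = X + (Y - X)` and `c = b + (c - b)`. -/
theorem sq_div_sub_sq_div_le {b c X Y : ℝ} (hX : 0 < X) (hXY : X < Y) :
    c ^ 2 / Y - b ^ 2 / X ≤ (c - b) ^ 2 / (Y - X) := by
  have hY : 0 < Y := hX.trans hXY
  have hd : 0 < Y - X := sub_pos.2 hXY
  have key : (c - b) ^ 2 / (Y - X) - (c ^ 2 / Y - b ^ 2 / X)
      = (c * X - b * Y) ^ 2 / (X * Y * (Y - X)) := by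
    field_simp
    ring
  have : 0 ≤ (c * X - b * Y) ^ 2 / (X * Y * (Y - X)) := by positivity
  linarith

/-- The maximum principle along a line. The first-order condition determines the difference of the
derivatives of the `aᵢ ^ (1 - p)`; subadditivity of `ξ² / w` bounds by it the quadratic terms in the
second-order condition. -/
theorem deriv_two_le_of_isLocalMax_rpow_sub_rpow {p η c₀ c₁ A₁ A₂ : ℝ} (hp0 : 0 < p) (hp1 : p < 1)
    {a₁ a₂ a₁' a₂' : ℝ → ℝ} (ha₁ : ∀ t, HasDerivAt a₁ (a₁' t) t)
    (ha₂ : ∀ t, HasDerivAt a₂ (a₂' t) t) (ha₁' : HasDerivAt a₁' A₁ 0) (ha₂' : HasDerivAt a₂' A₂ 0)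
    (hpos : 0 < a₁ 0) (hlt : a₁ 0 < a₂ 0)
    (hmax : IsLocalMax
      (fun t => a₂ t ^ (1 - p) - a₁ t ^ (1 - p) + η * (c₀ + 2 * c₁ * t + t ^ 2)) 0) :
    A₂ / a₂ 0 ^ p - A₁ / a₁ 0 ^ p ≤
      4 * p * η ^ 2 / ((1 - p) ^ 2 * (a₂ 0 ^ (1 - p) - a₁ 0 ^ (1 - p))) * c₁ ^ 2
        - 2 * η / (1 - p) := by
  have hpos₂ : 0 < a₂ 0 := hpos.trans hlt
  have hq : 0 < 1 - p := sub_pos.2 hp1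
  have hev₁ : ∀ᶠ t in 𝓝 (0 : ℝ), 0 < a₁ t := (ha₁ 0).continuousAt.eventually_const_lt hpos
  have hev₂ : ∀ᶠ t in 𝓝 (0 : ℝ), 0 < a₂ t := (ha₂ 0).continuousAt.eventually_const_lt hpos₂
  have hquad : ∀ t : ℝ, HasDerivAt (fun t => η * (c₀ + 2 * c₁ * t + t ^ 2))
      (η * (2 * c₁ + 2 * t)) t := by
    intro t
    have h1 := (((hasDerivAt_id t).const_mul (2 * c₁)).const_add c₀).add (hasDerivAt_pow 2 t)
    exact (h1.const_mul η).congr_deriv (by simp)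
  have hd : ∀ᶠ t in 𝓝 (0 : ℝ), HasDerivAt
      (fun t => a₂ t ^ (1 - p) - a₁ t ^ (1 - p) + η * (c₀ + 2 * c₁ * t + t ^ 2))
      (a₂' t * (1 - p) * a₂ t ^ (1 - p - 1) - a₁' t * (1 - p) * a₁ t ^ (1 - p - 1)
        + η * (2 * c₁ + 2 * t)) t := by
    filter_upwards [hev₁, hev₂] with t h1 h2
    exact (((ha₂ t).rpow_const (Or.inl h2.ne')).sub ((ha₁ t).rpow_const (Or.inl h1.ne'))).add
      (hquad t)
  have hd2 : HasDerivAt (fun t => a₂' t * (1 - p) * a₂ t ^ (1 - p - 1)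
        - a₁' t * (1 - p) * a₁ t ^ (1 - p - 1) + η * (2 * c₁ + 2 * t))
      ((A₂ * (1 - p) * a₂ 0 ^ (1 - p - 1)
          + a₂' 0 * (1 - p) * (a₂' 0 * (1 - p - 1) * a₂ 0 ^ (1 - p - 1 - 1)))
        - (A₁ * (1 - p) * a₁ 0 ^ (1 - p - 1)
          + a₁' 0 * (1 - p) * (a₁' 0 * (1 - p - 1) * a₁ 0 ^ (1 - p - 1 - 1))) + η * 2) 0 := by
    refine (((ha₂'.mul_const _).mul ((ha₂ 0).rpow_const (Or.inl hpos₂.ne'))).sub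
      ((ha₁'.mul_const _).mul ((ha₁ 0).rpow_const (Or.inl hpos.ne')))).add ?_
    exact ((((hasDerivAt_id (0 : ℝ)).const_mul 2).const_add (2 * c₁)).const_mul η).congr_deriv
      (by simp)
  have hfirst := hmax.hasDerivAt_eq_zero hd.self_of_nhds
  have hsecond := hmax.hasDerivAt_hasDerivAt_nonpos hd hd2
  have hXlt : a₁ 0 ^ (1 - p) < a₂ 0 ^ (1 - p) := Real.rpow_lt_rpow hpos.le hlt hq
  have hX₁ : 0 < a₁ 0 ^ (1 - p) := Real.rpow_pos_of_pos hpos _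
  have hX₂ : 0 < a₂ 0 ^ (1 - p) := Real.rpow_pos_of_pos hpos₂ _
  have hpow : ∀ s : ℝ, 0 < s → s ^ (1 - p - 1) = (s ^ p)⁻¹ := fun s hs => by
    rw [← Real.rpow_neg hs.le]; congr 1; ring
  have hpow2 : ∀ s : ℝ, 0 < s → s ^ (1 - p - 1 - 1) = ((s ^ p)⁻¹) ^ 2 / s ^ (1 - p) :=
    fun s hs => by
      rw [← Real.rpow_neg hs.le, ← Real.rpow_natCast, ← Real.rpow_mul hs.le, ← Real.rpow_sub hs]
      congr 1; push_cast; ring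
  -- With `X = a ^ (1 - p)` and `Y = a ^ (-p)`, the power in the second derivative is `Y² / X`.
  rw [hpow _ hpos, hpow _ hpos₂] at hfirst hsecond
  rw [hpow2 _ hpos, hpow2 _ hpos₂] at hsecond
  have hS := sq_div_sub_sq_div_le (b := a₁' 0 * (a₁ 0 ^ p)⁻¹) (c := a₂' 0 * (a₂ 0 ^ p)⁻¹) hX₁ hXlt
  simp only [div_eq_mul_inv (A₂), div_eq_mul_inv (A₁)]
  generalize a₁ 0 ^ (1 - p) = X₁ at *
  generalize a₂ 0 ^ (1 - p) = X₂ at *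
  generalize (a₁ 0 ^ p)⁻¹ = Y₁ at *
  generalize (a₂ 0 ^ p)⁻¹ = Y₂ at *
  have hdiff : a₂' 0 * Y₂ - a₁' 0 * Y₁ = -(2 * η * c₁) / (1 - p) := by
    field_simp
    linarith
  rw [hdiff] at hS
  have hD : 0 < X₂ - X₁ := sub_pos.2 hXlt
  have e1 : 4 * p * η ^ 2 / ((1 - p) ^ 2 * (X₂ - X₁)) * c₁ ^ 2
      = p * ((-(2 * η * c₁) / (1 - p)) ^ 2 / (X₂ - X₁)) := by
    field_simp
    ring
  have e2 : A₂ * Y₂ - A₁ * Y₁ ≤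
      p * ((a₂' 0 * Y₂) ^ 2 / X₂ - (a₁' 0 * Y₁) ^ 2 / X₁) - 2 * η / (1 - p) := by
    rw [← mul_le_mul_iff_right₀ hq]
    have e3 : (1 - p) * (p * ((a₂' 0 * Y₂) ^ 2 / X₂ - (a₁' 0 * Y₁) ^ 2 / X₁) - 2 * η / (1 - p))
        = (1 - p) * p * ((a₂' 0 * Y₂) ^ 2 / X₂ - (a₁' 0 * Y₁) ^ 2 / X₁) - 2 * η := by
      field_simp
    rw [e3]
    have e4 : ∀ A Y X a : ℝ, A * (1 - p) * Y + a * (1 - p) * (a * (1 - p - 1) * (Y ^ 2 / X))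
        = (1 - p) * (A * Y) - (1 - p) * p * ((a * Y) ^ 2 / X) := by
      intros; ring
    rw [e4, e4] at hsecond
    linarith
  rw [e1]
  have := mul_le_mul_of_nonneg_left hS hp0.le
  linarith

theorem laplacian_eq_sum_fderiv_fderiv {N : ℕ} {U : EuclideanSpace ℝ (Fin N) → ℝ}
    (hU : ContDiff ℝ 2 U) (x : EuclideanSpace ℝ (Fin N)) :
    (Δ U) x = ∑ i, fderiv ℝ (fun y => fderiv ℝ U y (EuclideanSpace.single i 1)) x
      (EuclideanSpace.single i 1) := by
  have hd : DifferentiableAt ℝ (fderiv ℝ U) x :=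
    (hU.fderiv_right (m := 1) (by norm_num)).differentiable (by norm_num) x
  rw [InnerProductSpace.laplacian_eq_iteratedFDeriv_orthonormalBasis U
    (EuclideanSpace.basisFun (Fin N) ℝ)]
  refine Finset.sum_congr rfl fun i _ => ?_
  rw [iteratedFDeriv_two_apply, fderiv_clm_apply hd (differentiableAt_const _)]
  simp

/-- The maximum principle for smooth functions: the sum of the one-dimensional inequalities over
the coordinate directions. The last term, of first order in `η`, beats the other one, of second
order, when `η` is small. -/
theorem laplacian_div_sub_le_of_isLocalMax {N : ℕ} {p η : ℝ} (hp0 : 0 < p) (hp1 : p < 1)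
    {U₁ U₂ : EuclideanSpace ℝ (Fin N) → ℝ} (hU₁ : ContDiff ℝ 2 U₁) (hU₂ : ContDiff ℝ 2 U₂)
    {x : EuclideanSpace ℝ (Fin N)} (hpos : 0 < U₁ x) (hlt : U₁ x < U₂ x)
    (hmax : IsLocalMax (fun y => U₂ y ^ (1 - p) - U₁ y ^ (1 - p) + η * ‖y‖ ^ 2) x) :
    (Δ U₂) x / U₂ x ^ p - (Δ U₁) x / U₁ x ^ p ≤
      4 * p * η ^ 2 / ((1 - p) ^ 2 * (U₂ x ^ (1 - p) - U₁ x ^ (1 - p))) * ‖x‖ ^ 2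
        - N * (2 * η / (1 - p)) := by
  have hline : ∀ i : Fin N, ∀ t : ℝ, HasDerivAt
      (fun t : ℝ => x + t • EuclideanSpace.single i (1 : ℝ)) (EuclideanSpace.single i 1) t := by
    intro i t
    simpa using ((hasDerivAt_id t).smul_const (EuclideanSpace.single i (1 : ℝ))).const_add x
  have h1 : ∀ U : EuclideanSpace ℝ (Fin N) → ℝ, ContDiff ℝ 2 U → ∀ i : Fin N, ∀ t : ℝ,
      HasDerivAt (fun t : ℝ => U (x + t • EuclideanSpace.single i (1 : ℝ)))
        (fderiv ℝ U (x + t • EuclideanSpace.single i (1 : ℝ)) (EuclideanSpace.single i 1)) t :=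
    fun U hU i t =>
      ((hU.differentiable (by norm_num)) _).hasFDerivAt.comp_hasDerivAt t (hline i t)
  have h2 : ∀ U : EuclideanSpace ℝ (Fin N) → ℝ, ContDiff ℝ 2 U → ∀ i : Fin N,
      HasDerivAt (fun t : ℝ =>
          fderiv ℝ U (x + t • EuclideanSpace.single i (1 : ℝ)) (EuclideanSpace.single i 1))
        (fderiv ℝ (fun y => fderiv ℝ U y (EuclideanSpace.single i 1)) x
          (EuclideanSpace.single i 1)) 0 := by
    intro U hU i
    have hd : DifferentiableAt ℝ (fun y => fderiv ℝ U y (EuclideanSpace.single i 1))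
        (x + (0 : ℝ) • EuclideanSpace.single i (1 : ℝ)) :=
      (((hU.fderiv_right (m := 1) (by norm_num)).clm_apply contDiff_const).differentiable
        (by norm_num)) _
    have hcomp := hd.hasFDerivAt.comp_hasDerivAt (0 : ℝ) (hline i 0)
    rw [zero_smul, add_zero] at hcomp
    exact hcomp
  have hdir : ∀ i : Fin N,
      fderiv ℝ (fun y => fderiv ℝ U₂ y (EuclideanSpace.single i 1)) x
          (EuclideanSpace.single i 1) / U₂ x ^ p
        - fderiv ℝ (fun y => fderiv ℝ U₁ y (EuclideanSpace.single i 1)) x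
          (EuclideanSpace.single i 1) / U₁ x ^ p ≤
      4 * p * η ^ 2 / ((1 - p) ^ 2 * (U₂ x ^ (1 - p) - U₁ x ^ (1 - p))) * x i ^ 2
        - 2 * η / (1 - p) := by
    intro i
    have hnorm : ∀ t : ℝ, ‖x + t • EuclideanSpace.single i (1 : ℝ)‖ ^ 2
        = ‖x‖ ^ 2 + 2 * x i * t + t ^ 2 := by
      intro t
      rw [norm_add_sq_real, inner_smul_right, norm_smul, EuclideanSpace.inner_single_right]
      simp
      ring
    have hmax' : IsLocalMax (fun t : ℝ => U₂ (x + t • EuclideanSpace.single i (1 : ℝ)) ^ (1 - p)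
        - U₁ (x + t • EuclideanSpace.single i (1 : ℝ)) ^ (1 - p)
        + η * (‖x‖ ^ 2 + 2 * x i * t + t ^ 2)) 0 := by
      simp only [← hnorm]
      have hc : Tendsto (fun t : ℝ => x + t • EuclideanSpace.single i (1 : ℝ)) (𝓝 0) (𝓝 x) := by
        simpa using (hline i 0).continuousAt.tendsto
      have := hc.eventually hmax
      simpa [IsLocalMax, IsMaxFilter] using this
    simpa using deriv_two_le_of_isLocalMax_rpow_sub_rpow hp0 hp1 (h1 U₁ hU₁ i) (h1 U₂ hU₂ i)
      (h2 U₁ hU₁ i) (h2 U₂ hU₂ i) (by simpa using hpos) (by simpa using hlt) hmax'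
  have hsum := Finset.sum_le_sum fun i (_ : i ∈ Finset.univ) => hdir i
  rw [laplacian_eq_sum_fderiv_fderiv hU₁, laplacian_eq_sum_fderiv_fderiv hU₂,
    EuclideanSpace.real_norm_sq_eq]
  simpa [Finset.sum_sub_distrib, Finset.sum_div, Finset.mul_sum] using hsum

/-! ### Mollification of distributional inequalities -/

open scoped Convolution in
theorem fderiv_convolution_lsmul_apply {N : ℕ} {g φ : EuclideanSpace ℝ (Fin N) → ℝ}
    (hg : LocallyIntegrable g) (hφ : ContDiff ℝ 1 φ) (hφc : HasCompactSupport φ)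
    (x v : EuclideanSpace ℝ (Fin N)) :
    fderiv ℝ (g ⋆[ContinuousLinearMap.lsmul ℝ ℝ, volume] φ) x v =
      (g ⋆[ContinuousLinearMap.lsmul ℝ ℝ, volume] fun y => fderiv ℝ φ y v) x := by
  rw [(hφc.hasFDerivAt_convolution_right (ContinuousLinearMap.lsmul ℝ ℝ) hg hφ x).fderiv,
    convolution_precompR_apply _ hg (hφc.fderiv ℝ) (hφ.continuous_fderiv (by norm_num))]

open scoped Convolution in
theorem laplacian_convolution_lsmul {N : ℕ} {g φ : EuclideanSpace ℝ (Fin N) → ℝ}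
    (hg : LocallyIntegrable g) (hφ : ContDiff ℝ 2 φ) (hφc : HasCompactSupport φ)
    (x : EuclideanSpace ℝ (Fin N)) :
    (Δ (g ⋆[ContinuousLinearMap.lsmul ℝ ℝ, volume] φ)) x = ∫ y, g y * (Δ φ) (x - y) := by
  have hφ1 : ContDiff ℝ 1 φ := hφ.of_le (by norm_num)
  have hd : ∀ i : Fin N, ContDiff ℝ 1 fun y => fderiv ℝ φ y (EuclideanSpace.single i 1) :=
    fun i => (hφ.fderiv_right (m := 1) (by norm_num)).clm_apply contDiff_const
  have hdc : ∀ i : Fin N,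
      HasCompactSupport fun y => fderiv ℝ φ y (EuclideanSpace.single i 1) :=
    fun i => hφc.fderiv_apply ℝ _
  have hd2 : ∀ i : Fin N, Continuous fun y => fderiv ℝ
      (fun z => fderiv ℝ φ z (EuclideanSpace.single i 1)) y (EuclideanSpace.single i 1) :=
    fun i => ((hd i).continuous_fderiv (by norm_num)).clm_apply continuous_const
  rw [laplacian_eq_sum_fderiv_fderiv
    (hφc.contDiff_convolution_right (n := 2) (ContinuousLinearMap.lsmul ℝ ℝ) hg hφ)]
  simp only [fderiv_convolution_lsmul_apply hg hφ1 hφc]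
  simp_rw [fun i : Fin N => fderiv_convolution_lsmul_apply hg (hd i) (hdc i) x
    (EuclideanSpace.single i 1)]
  simp only [convolution_def, ContinuousLinearMap.lsmul_apply, smul_eq_mul]
  rw [← integral_finsetSum]
  · simp only [laplacian_eq_sum_fderiv_fderiv hφ, Finset.mul_sum]
  · intro i _
    exact ((hdc i).fderiv_apply ℝ _).convolutionExists_right
      (ContinuousLinearMap.lsmul ℝ ℝ) hg (hd2 i) x

theorem laplacian_comp_const_sub {N : ℕ} {φ : EuclideanSpace ℝ (Fin N) → ℝ}
    (hφ : ContDiff ℝ 2 φ) (x y : EuclideanSpace ℝ (Fin N)) :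
    (Δ (fun z => φ (x - z))) y = (Δ φ) (x - y) := by
  have key : ∀ f : EuclideanSpace ℝ (Fin N) → ℝ, Differentiable ℝ f →
      ∀ z v, fderiv ℝ (fun z => f (x - z)) z v = -fderiv ℝ f (x - z) v := by
    intro f hf z v
    have h := (hf (x - z)).hasFDerivAt.comp z ((hasFDerivAt_id z).const_sub x)
    have h' : fderiv ℝ (fun z => f (x - z)) z = _ := h.fderiv
    rw [h']
    simp
  have hφx : ContDiff ℝ 2 fun z => φ (x - z) := hφ.comp (contDiff_const.sub contDiff_id)
  rw [laplacian_eq_sum_fderiv_fderiv hφx, laplacian_eq_sum_fderiv_fderiv hφ]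
  refine Finset.sum_congr rfl fun i _ => ?_
  have hd : Differentiable ℝ fun y => fderiv ℝ φ y (EuclideanSpace.single i 1) :=
    ((hφ.fderiv_right (m := 1) (by norm_num)).clm_apply contDiff_const).differentiable
      (by norm_num)
  have e : (fun z => fderiv ℝ (fun z => φ (x - z)) z (EuclideanSpace.single i 1))
      = fun z => -(fun w => fderiv ℝ φ w (EuclideanSpace.single i 1)) (x - z) :=
    funext fun z => key φ (hφ.differentiable (by norm_num)) z _
  change fderiv ℝ (fun z => fderiv ℝ (fun z => φ (x - z)) z (EuclideanSpace.single i 1)) y _ = _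
  rw [e, fderiv_fun_neg]
  change -(fderiv ℝ _ y _) = _
  rw [key _ hd, neg_neg]

theorem integrable_mul_of_continuousOn_tsupport {E : Type*} [TopologicalSpace E] [T2Space E]
    [MeasurableSpace E] [OpensMeasurableSpace E] {μ : Measure E} [IsFiniteMeasureOnCompacts μ]
    {F ψ : E → ℝ} (hF : ContinuousOn F (tsupport ψ)) (hψ : Continuous ψ)
    (hψc : HasCompactSupport ψ) : Integrable (fun y => F y * ψ y) μ := by
  rw [← integrableOn_iff_integrable_of_support_subset (s := tsupport ψ)]
  · exact (hF.mul hψ.continuousOn).integrableOn_compact hψc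
  · exact (Function.support_mul_subset_right _ _).trans (subset_tsupport ψ)

open scoped Convolution in
/-- Testing `Δu + F` against the translated reflected kernel `φ(x - ·)` gives the value at `x` of
the mollification of `Δu + F`; the Laplacian may then be moved onto the mollified function. -/
theorem exists_laplacianAddPairing_eq_convolution {N : ℕ}
    {D : Opens (EuclideanSpace ℝ (Fin N))} {u F φ : EuclideanSpace ℝ (Fin N) → ℝ}
    (hu : IntegrableOn u D) (hF : ContinuousOn F D) (hφ : ContDiff ℝ ∞ φ)
    (hφc : HasCompactSupport φ) {x : EuclideanSpace ℝ (Fin N)}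
    (hx : tsupport (fun y => φ (x - y)) ⊆ D) :
    ∃ ψ : 𝓓(D, ℝ), (∀ y, ψ y = φ (x - y)) ∧ laplacianAddPairing D u F ψ =
      (Δ (indicator D u ⋆[ContinuousLinearMap.lsmul ℝ ℝ, volume] φ)) x
        + (indicator D F ⋆[ContinuousLinearMap.lsmul ℝ ℝ, volume] φ) x := by
  have hDm : MeasurableSet (D : Set (EuclideanSpace ℝ (Fin N))) := D.isOpen.measurableSet
  have hφ2 : ContDiff ℝ 2 φ := contDiff_infty.1 hφ 2
  have hψ : ContDiff ℝ ∞ fun y => φ (x - y) := hφ.comp (contDiff_const.sub contDiff_id)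
  have hψc : HasCompactSupport fun y => φ (x - y) :=
    hφc.comp_homeomorph (Homeomorph.subLeft x)
  refine ⟨⟨fun y => φ (x - y), hψ, hψc, hx⟩, fun y => rfl, ?_⟩
  have hui : Integrable (indicator (D : Set (EuclideanSpace ℝ (Fin N))) u) :=
    (integrable_indicator_iff hDm).2 hu
  have hΔ : Continuous (Δ φ) := by
    rw [funext (laplacian_eq_sum_fderiv_fderiv hφ2)]
    refine continuous_finsetSum _ fun i _ => ?_
    exact ((((hφ2.fderiv_right (m := 1) (by norm_num)).clm_apply contDiff_const).continuous_fderiv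
      (by norm_num)).clm_apply continuous_const)
  have hΔc : HasCompactSupport (Δ φ) := by
    refine HasCompactSupport.intro hφc fun y hy => ?_
    have h0 : φ =ᶠ[𝓝 y] fun _ => 0 := notMem_tsupport_iff_eventuallyEq.1 hy
    rw [(InnerProductSpace.laplacian_congr_nhds h0).self_of_nhds,
      InnerProductSpace.laplacian_const]
    rfl
  have hint : Integrable fun y => indicator (D : Set (EuclideanSpace ℝ (Fin N))) u y
      * (Δ φ) (x - y) :=
    hΔc.convolutionExists_right (ContinuousLinearMap.lsmul ℝ ℝ) hui.locallyIntegrable hΔ x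
  have hint2 : Integrable fun y => indicator (D : Set (EuclideanSpace ℝ (Fin N))) F y
      * φ (x - y) := by
    refine integrable_mul_of_continuousOn_tsupport ?_ hψ.continuous hψc
    refine (hF.mono hx).congr fun y hy => ?_
    rw [indicator_of_mem (hx hy)]
  rw [laplacian_convolution_lsmul hui.locallyIntegrable hφ2 hφc x, convolution_def]
  simp only [ContinuousLinearMap.lsmul_apply, smul_eq_mul]
  rw [← integral_add hint hint2, laplacianAddPairing, ← integral_indicator hDm]
  congr 1
  funext y
  by_cases hy : y ∈ (D : Set (EuclideanSpace ℝ (Fin N)))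
  · simp only [indicator_of_mem hy]
    congr 2
    exact laplacian_comp_const_sub hφ2 x y
  · simp [indicator_of_notMem hy]

open scoped Convolution in
/-- Mollifications of a function continuous in `D` converge continuously: the point of evaluation
may move with the kernel. No integrability of `g` near `∂D` is required. -/
theorem tendsto_convolution_indicator {N : ℕ} {D : Opens (EuclideanSpace ℝ (Fin N))}
    {g : EuclideanSpace ℝ (Fin N) → ℝ} (hg : ContinuousOn g D) {ι : Type*} {l : Filter ι}
    {φ : ι → ContDiffBump (0 : EuclideanSpace ℝ (Fin N))}
    (hφ : Tendsto (fun i => (φ i).rOut) l (𝓝 0)) {k : ι → EuclideanSpace ℝ (Fin N)}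
    {x : EuclideanSpace ℝ (Fin N)} (hx : x ∈ D) (hk : Tendsto k l (𝓝 x)) :
    Tendsto (fun i => (indicator D g ⋆[ContinuousLinearMap.lsmul ℝ ℝ, volume]
      (φ i).normed volume) (k i)) l (𝓝 (g x)) := by
  have hcont : Tendsto (indicator (D : Set (EuclideanSpace ℝ (Fin N))) g) (𝓝 x) (𝓝 (g x)) := by
    have hD : (D : Set (EuclideanSpace ℝ (Fin N))) ∈ 𝓝 x := D.isOpen.mem_nhds hx
    refine (hg.continuousAt hD).tendsto.congr' ?_
    filter_upwards [hD] with y hy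
    rw [indicator_of_mem hy]
  have hmeas : AEStronglyMeasurable (indicator (D : Set (EuclideanSpace ℝ (Fin N))) g) volume :=
    (aestronglyMeasurable_indicator_iff D.isOpen.measurableSet).2
      (hg.aestronglyMeasurable D.isOpen.measurableSet)
  have h := ContDiffBump.convolution_tendsto_right (μ := volume)
    (g := fun _ : ι => indicator (D : Set (EuclideanSpace ℝ (Fin N))) g)
    hφ (Eventually.of_forall fun _ => hmeas) (hcont.comp tendsto_snd) hk
  refine h.congr fun i => ?_
  rw [convolution_lsmul_swap, convolution_def]
  simp only [ContinuousLinearMap.lsmul_apply, smul_eq_mul, mul_comm]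

theorem eventually_tsupport_normed_subset {N : ℕ} {D : Opens (EuclideanSpace ℝ (Fin N))}
    {ι : Type*} {l : Filter ι} {φ : ι → ContDiffBump (0 : EuclideanSpace ℝ (Fin N))}
    (hφ : Tendsto (fun i => (φ i).rOut) l (𝓝 0)) {k : ι → EuclideanSpace ℝ (Fin N)}
    {x : EuclideanSpace ℝ (Fin N)} (hx : x ∈ D) (hk : Tendsto k l (𝓝 x)) :
    ∀ᶠ i in l, tsupport (fun y => (φ i).normed volume (k i - y)) ⊆ D := by
  obtain ⟨ε, hε, hball⟩ := Metric.isOpen_iff.1 D.isOpen x hx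
  filter_upwards [hφ.eventually_lt_const (half_pos hε),
    hk.eventually (Metric.ball_mem_nhds x (half_pos hε))] with i hi hki
  have hsub : tsupport (fun y => (φ i).normed volume (k i - y)) ⊆
      Metric.closedBall (k i) (φ i).rOut := by
    refine closure_minimal (fun y hy => ?_) Metric.isClosed_closedBall
    have : k i - y ∈ Function.support ((φ i).normed volume) := hy
    rw [(φ i).support_normed_eq, mem_ball_zero_iff, ← dist_eq_norm, dist_comm] at this
    exact this.le
  refine hsub.trans fun y hy => hball ?_
  have h1 : dist y (k i) ≤ (φ i).rOut := hy
  have h2 : dist (k i) x < ε / 2 := hki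
  have := dist_triangle y (k i) x
  exact Metric.mem_ball.2 (by linarith)

/-! ### The comparison principle -/

/-- A function whose upper limit at `∂D` is nonpositive is at least `δ > 0` only in a compact
subset of `D`. -/
theorem exists_isCompact_of_limsup_toBoundary_le {N : ℕ} {D : Opens (EuclideanSpace ℝ (Fin N))}
    (hD : Bornology.IsBounded (D : Set (EuclideanSpace ℝ (Fin N))))
    {v : EuclideanSpace ℝ (Fin N) → ℝ}
    (hv : limsup (fun x => (v x : EReal)) (toBoundary D) ≤ 0) {δ : ℝ} (hδ : 0 < δ) :
    ∃ C : Set (EuclideanSpace ℝ (Fin N)), IsCompact C ∧ C ⊆ D ∧ ∀ x ∈ D, δ ≤ v x → x ∈ C := by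
  have hev : ∀ᶠ x in toBoundary D, (v x : EReal) < (δ : EReal) :=
    eventually_lt_of_limsup_lt (hv.trans_lt (by exact_mod_cast hδ))
  rw [toBoundary, eventually_inf_principal] at hev
  obtain ⟨V, hV, hfV, hVv⟩ := mem_nhdsSet_iff_exists.1 hev
  refine ⟨closure D \ V, hD.isCompact_closure.diff hV, fun x hx => ?_, fun x hx hδx => ?_⟩
  · by_contra hxD
    refine hx.2 (hfV ⟨hx.1, ?_⟩)
    rwa [D.isOpen.interior_eq]
  · refine ⟨subset_closure hx, fun hxV => ?_⟩
    have := hVv hxV hx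
    exact absurd (EReal.coe_lt_coe_iff.1 this) (not_lt.2 hδx)

open scoped Convolution in
/-- The comparison principle for `Δu + F`, when `F₂ / u₂ ^ p ≤ F₁ / u₁ ^ p` wherever `u₁ < u₂`. -/
theorem le_of_laplacianAdd_of_limsup_le {N : ℕ} (hN : 1 ≤ N)
    {D : Opens (EuclideanSpace ℝ (Fin N))}
    (hD : Bornology.IsBounded (D : Set (EuclideanSpace ℝ (Fin N))))
    {p : ℝ} (hp0 : 0 < p) (hp1 : p < 1) {u₁ u₂ F₁ F₂ : EuclideanSpace ℝ (Fin N) → ℝ}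
    (hu₁i : IntegrableOn u₁ D) (hu₂i : IntegrableOn u₂ D)
    (hu₁ : ContinuousOn u₁ D) (hu₂ : ContinuousOn u₂ D)
    (hu₁_pos : ∀ x ∈ D, 0 < u₁ x) (hu₂_pos : ∀ x ∈ D, 0 < u₂ x)
    (hF₁ : ContinuousOn F₁ D) (hF₂ : ContinuousOn F₂ D)
    (hF : ∀ x ∈ D, u₁ x < u₂ x → F₂ x / u₂ x ^ p ≤ F₁ x / u₁ x ^ p)
    (h_super : LaplacianAddNonpos D u₁ F₁) (h_sub : LaplacianAddNonneg D u₂ F₂)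
    (h_bdry : limsup (fun x => ((u₂ x - u₁ x : ℝ) : EReal)) (toBoundary D) ≤ 0) :
    ∀ x ∈ D, u₂ x ≤ u₁ x := by
  intro x₀ hx₀
  by_contra! hlt₀
  have hq : 0 < 1 - p := sub_pos.2 hp1
  obtain ⟨M, hM⟩ : ∃ M, M = u₂ x₀ ^ (1 - p) - u₁ x₀ ^ (1 - p) := ⟨_, rfl⟩
  have hMpos : 0 < M := by
    rw [hM, sub_pos]
    exact Real.rpow_lt_rpow (hu₁_pos x₀ hx₀).le hlt₀ hq
  -- With `W = u₂ ^ (1 - p) - u₁ ^ (1 - p)`, by subadditivity of `t ^ (1 - p)` the inequality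
  -- `W ≥ M / 2` forces `u₂ - u₁ ≥ (M / 2) ^ (1 / (1 - p))`.
  obtain ⟨C, hC, hCD, hCmem⟩ := exists_isCompact_of_limsup_toBoundary_le hD h_bdry
    (δ := (M / 2) ^ (1 - p)⁻¹) (by positivity)
  have hWC : ∀ x ∈ D, M / 2 ≤ u₂ x ^ (1 - p) - u₁ x ^ (1 - p) → x ∈ C := by
    intro x hx hMx
    refine hCmem x hx ?_
    have h1 := hu₁_pos x hx
    have hle : u₁ x ≤ u₂ x := by
      by_contra! hcon
      have := Real.rpow_le_rpow (hu₂_pos x hx).le hcon.le hq.le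
      linarith
    have hsub : u₂ x ^ (1 - p) ≤ u₁ x ^ (1 - p) + (u₂ x - u₁ x) ^ (1 - p) := by
      have := Real.rpow_add_le_add_rpow h1.le (sub_nonneg.2 hle) hq.le (by linarith)
      simpa using this
    calc (M / 2) ^ (1 - p)⁻¹ ≤ ((u₂ x - u₁ x) ^ (1 - p)) ^ (1 - p)⁻¹ :=
          Real.rpow_le_rpow (by positivity) (by linarith) (by positivity)
      _ = u₂ x - u₁ x := Real.rpow_rpow_inv (sub_nonneg.2 hle) hq.ne'
  obtain ⟨K, hK, hCK, hKD⟩ := exists_compact_between hC D.isOpen hCD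
  obtain ⟨R, hR, hDR⟩ := hD.exists_pos_norm_le
  -- This `η` satisfies both `η R² ≤ M / 2`, which keeps the maximum point in `{W ≥ M / 2}`, and
  -- `4 p η R² < (1 - p) M`, which gives the contradiction.
  obtain ⟨η, hη⟩ : ∃ η, η = (1 - p) * M / (8 * R ^ 2) := ⟨_, rfl⟩
  have hηpos : 0 < η := by rw [hη]; positivity
  have hηR : η * R ^ 2 = (1 - p) * M / 8 := by rw [hη]; field_simp
  have hsq : ∀ x ∈ D, ‖x‖ ^ 2 ≤ R ^ 2 := fun x hx =>
    pow_le_pow_left₀ (norm_nonneg x) (hDR x hx) 2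
  let φ : ℕ → ContDiffBump (0 : EuclideanSpace ℝ (Fin N)) := fun k =>
    ⟨1 / ((k : ℝ) + 1) / 2, 1 / ((k : ℝ) + 1), by positivity, half_lt_self (by positivity)⟩
  have hφ : Tendsto (fun k => (φ k).rOut) atTop (𝓝 0) := tendsto_one_div_add_atTop_nhds_zero_nat
  let m : (EuclideanSpace ℝ (Fin N) → ℝ) → ℕ → EuclideanSpace ℝ (Fin N) → ℝ := fun g k =>
    indicator D g ⋆[ContinuousLinearMap.lsmul ℝ ℝ, volume] (φ k).normed volume
  have hsmooth : ∀ g, IntegrableOn g D → ∀ k, ContDiff ℝ 2 (m g k) := fun g hg k =>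
    (φ k).hasCompactSupport_normed.contDiff_convolution_right (n := 2) _
      ((integrable_indicator_iff D.isOpen.measurableSet).2 hg).locallyIntegrable
      (φ k).contDiff_normed
  have hPcont : ∀ k, Continuous fun y =>
      m u₂ k y ^ (1 - p) - m u₁ k y ^ (1 - p) + η * ‖y‖ ^ 2 := fun k =>
    (((Real.continuous_rpow_const hq.le).comp (hsmooth u₂ hu₂i k).continuous).sub
      ((Real.continuous_rpow_const hq.le).comp (hsmooth u₁ hu₁i k).continuous)).add
      (continuous_const.mul (continuous_norm.pow 2))
  have hx₀C : x₀ ∈ C := hWC x₀ hx₀ (by linarith)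
  have hx₀K : x₀ ∈ K := interior_subset (hCK hx₀C)
  choose x hxK hxmax using fun k =>
    hK.exists_isMaxOn ⟨x₀, hx₀K⟩ (hPcont k).continuousOn
  obtain ⟨z, hzK, θ, hθ, hxz⟩ := hK.tendsto_subseq hxK
  have hzD : z ∈ D := hKD hzK
  have hφθ : Tendsto (fun k => (φ (θ k)).rOut) atTop (𝓝 0) := hφ.comp hθ.tendsto_atTop
  have hlim : ∀ g, ContinuousOn g D → ∀ (y : ℕ → EuclideanSpace ℝ (Fin N)) (w), w ∈ D →
      Tendsto y atTop (𝓝 w) → Tendsto (fun k => m g (θ k) (y k)) atTop (𝓝 (g w)) :=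
    fun g hg y w hw hy => tendsto_convolution_indicator hg hφθ hw hy
  have hW : ∀ (y : ℕ → EuclideanSpace ℝ (Fin N)) (w), w ∈ D → Tendsto y atTop (𝓝 w) →
      Tendsto (fun k => m u₂ (θ k) (y k) ^ (1 - p) - m u₁ (θ k) (y k) ^ (1 - p)) atTop
        (𝓝 (u₂ w ^ (1 - p) - u₁ w ^ (1 - p))) := fun y w hw hy =>
    ((hlim u₂ hu₂ y w hw hy).rpow_const (Or.inr hq.le)).sub
      ((hlim u₁ hu₁ y w hw hy).rpow_const (Or.inr hq.le))
  -- The limit `z` of the maximum points maximizes the limit function on `K`.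
  have hP : u₂ x₀ ^ (1 - p) - u₁ x₀ ^ (1 - p) + η * ‖x₀‖ ^ 2
      ≤ u₂ z ^ (1 - p) - u₁ z ^ (1 - p) + η * ‖z‖ ^ 2 :=
    le_of_tendsto_of_tendsto'
      ((hW (fun _ => x₀) x₀ hx₀ tendsto_const_nhds).add_const _)
      ((hW _ z hzD hxz).add ((hxz.norm.pow 2).const_mul η))
      fun k => hxmax (θ k) hx₀K
  have hWz : M / 2 ≤ u₂ z ^ (1 - p) - u₁ z ^ (1 - p) := by
    have h1 := mul_le_mul_of_nonneg_left (hsq z hzD) hηpos.le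
    have h2 : 0 ≤ η * ‖x₀‖ ^ 2 := by positivity
    nlinarith
  have hzint : z ∈ interior K := hCK (hWC z hzD hWz)
  have hz₁ := hu₁_pos z hzD
  have hz₂ := hu₂_pos z hzD
  have hzlt : u₁ z < u₂ z := by
    by_contra! hcon
    have := Real.rpow_le_rpow hz₂.le hcon hq.le
    linarith
  have hl₁ := hlim u₁ hu₁ _ z hzD hxz
  have hl₂ := hlim u₂ hu₂ _ z hzD hxz
  -- Since `z` is interior to `K`, the maxima over `K` are eventually local maxima.
  have hev : ∀ᶠ k in atTop,
      -m F₂ (θ k) (x (θ k)) / m u₂ (θ k) (x (θ k)) ^ p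
        - -m F₁ (θ k) (x (θ k)) / m u₁ (θ k) (x (θ k)) ^ p ≤
      4 * p * η ^ 2 / ((1 - p) ^ 2 * (m u₂ (θ k) (x (θ k)) ^ (1 - p)
        - m u₁ (θ k) (x (θ k)) ^ (1 - p))) * ‖x (θ k)‖ ^ 2 - N * (2 * η / (1 - p)) := by
    filter_upwards [hxz.eventually (isOpen_interior.mem_nhds hzint),
      hl₁.eventually_const_lt hz₁, hl₁.eventually_lt hl₂ hzlt,
      eventually_tsupport_normed_subset hφθ hzD hxz] with k hint hpos hlt hsupp
    refine le_trans ?_ (laplacian_div_sub_le_of_isLocalMax hp0 hp1 (hsmooth u₁ hu₁i (θ k))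
      (hsmooth u₂ hu₂i (θ k)) hpos hlt
      ((hxmax (θ k)).isLocalMax (mem_interior_iff_mem_nhds.1 hint)))
    obtain ⟨ψ₁, hψ₁, he₁⟩ := exists_laplacianAddPairing_eq_convolution hu₁i hF₁
      (φ (θ k)).contDiff_normed (φ (θ k)).hasCompactSupport_normed hsupp
    obtain ⟨ψ₂, hψ₂, he₂⟩ := exists_laplacianAddPairing_eq_convolution hu₂i hF₂
      (φ (θ k)).contDiff_normed (φ (θ k)).hasCompactSupport_normed hsupp
    have h1 := h_super ψ₁ fun y => by rw [hψ₁]; exact (φ (θ k)).nonneg_normed _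
    have h2 := h_sub ψ₂ fun y => by rw [hψ₂]; exact (φ (θ k)).nonneg_normed _
    rw [he₁] at h1
    rw [he₂] at h2
    have h1' : (Δ (m u₁ (θ k))) (x (θ k)) ≤ -m F₁ (θ k) (x (θ k)) :=
      le_neg_iff_add_nonpos_right.2 h1
    have h2' : -m F₂ (θ k) (x (θ k)) ≤ (Δ (m u₂ (θ k))) (x (θ k)) := neg_le_iff_add_nonneg.2 h2
    have hpos₂ := hpos.trans hlt
    exact sub_le_sub (div_le_div_of_nonneg_right h2' (Real.rpow_nonneg hpos₂.le p))
      (div_le_div_of_nonneg_right h1' (Real.rpow_nonneg hpos.le p))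
  have hpow₁ : u₁ z ^ p ≠ 0 := (Real.rpow_pos_of_pos hz₁ p).ne'
  have hpow₂ : u₂ z ^ p ≠ 0 := (Real.rpow_pos_of_pos hz₂ p).ne'
  have hWpos : 0 < u₂ z ^ (1 - p) - u₁ z ^ (1 - p) := by linarith
  have hfin := le_of_tendsto_of_tendsto
    (((hlim F₂ hF₂ _ z hzD hxz).neg.div (hl₂.rpow_const (Or.inr hp0.le)) hpow₂).sub
      ((hlim F₁ hF₁ _ z hzD hxz).neg.div (hl₁.rpow_const (Or.inr hp0.le)) hpow₁))
    ((((tendsto_const_nhds (x := 4 * p * η ^ 2)).div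
      ((hW _ z hzD hxz).const_mul ((1 - p) ^ 2)) (by positivity)).mul
        (hxz.norm.pow 2)).sub_const (N * (2 * η / (1 - p)))) hev
  have hFz := hF z hzD hzlt
  rw [neg_div, neg_div] at hfin
  have hbound : 4 * p * η ^ 2 / ((1 - p) ^ 2 * (u₂ z ^ (1 - p) - u₁ z ^ (1 - p))) * ‖z‖ ^ 2
      ≤ p * η / (1 - p) := by
    calc 4 * p * η ^ 2 / ((1 - p) ^ 2 * (u₂ z ^ (1 - p) - u₁ z ^ (1 - p))) * ‖z‖ ^ 2
        ≤ 4 * p * η ^ 2 / ((1 - p) ^ 2 * (M / 2)) * R ^ 2 := by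
          gcongr
          exact hDR z hzD
      _ = 8 * p * η * (η * R ^ 2) / ((1 - p) ^ 2 * M) := by field_simp; norm_num
      _ = p * η / (1 - p) := by rw [hηR]; field_simp
  have hNη : 2 * η / (1 - p) ≤ N * (2 * η / (1 - p)) :=
    le_mul_of_one_le_left (by positivity) (by exact_mod_cast hN)
  have hlast : p * η / (1 - p) < 2 * η / (1 - p) := by
    gcongr
    linarith
  linarith

theorem le_of_monotoneOn_Ioo_of_continuousOn_Icc {G : ℝ → ℝ} {s t : ℝ} (hst : s < t)
    (hG : ContinuousOn G (Icc s t))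
    (hmono : MonotoneOn G (Ioo s t)) : G s ≤ G t := by
  have hm : s < (s + t) / 2 ∧ (s + t) / 2 < t := by constructor <;> linarith
  have h1 : G s ≤ G ((s + t) / 2) := by
    have hc : Tendsto G (𝓝[>] s) (𝓝 (G s)) :=
      (hG s (left_mem_Icc.2 hst.le)).mono_left
        (nhdsWithin_le_of_mem (mem_of_superset (Ioo_mem_nhdsGT hst) Ioo_subset_Icc_self))
    refine le_of_tendsto hc ?_
    filter_upwards [Ioo_mem_nhdsGT hm.1] with y hy
    exact hmono ⟨hy.1, hy.2.trans hm.2⟩ hm hy.2.le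
  have h2 : G ((s + t) / 2) ≤ G t := by
    have hc : Tendsto G (𝓝[<] t) (𝓝 (G t)) :=
      (hG t (right_mem_Icc.2 hst.le)).mono_left
        (nhdsWithin_le_of_mem (mem_of_superset (Ioo_mem_nhdsLT hst) Ioo_subset_Icc_self))
    refine ge_of_tendsto hc ?_
    filter_upwards [Ioo_mem_nhdsLT hm.2] with y hy
    exact hmono hm ⟨hm.1.trans hy.1, hy.2⟩ hy.1.le
  exact h1.trans h2

theorem lemma1 {N : ℕ} (hN : 1 ≤ N) (D : Opens (EuclideanSpace ℝ (Fin N)))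
    (hD_conn : IsConnected (D : Set (EuclideanSpace ℝ (Fin N))))
    (hD_bdd : Bornology.IsBounded (D : Set (EuclideanSpace ℝ (Fin N))))
    (hD_smooth : HasSmoothBoundary D)
    (p : ℝ) (hp0 : 0 < p) (hp1 : p < 1) (a : ℝ)
    (α : ℝ≥0) (hα0 : 0 < α) (hα1 : α < 1)
    (h r : EuclideanSpace ℝ (Fin N) → ℝ)
    (hh : IsHolderOnClosure D α h) (hr : IsHolderOnClosure D α r)
    (hh_nonneg : ∀ x ∈ D, 0 ≤ h x) (hr_nonneg : ∀ x ∈ D, 0 ≤ r x)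
    (u₁ u₂ : EuclideanSpace ℝ (Fin N) → ℝ)
    (hu₁ : MemH1 D u₁) (hu₂ : MemH1 D u₂)
    (hu₁_cont : ContinuousOn u₁ D) (hu₂_cont : ContinuousOn u₂ D)
    (hu₁_pos : ∀ x ∈ D, 0 < u₁ x) (hu₂_pos : ∀ x ∈ D, 0 < u₂ x)
    (f : ℝ → ℝ) (hf_cont : ContinuousOn f (Ici 0))
    (hf_mono : MonotoneOn (fun t : ℝ => f t / t ^ p) (valueInterval D u₁ u₂))
    (h_super : LaplacianAddNonpos D u₁ (fun x => a * u₁ x ^ p - h x * f (u₁ x) + r x))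
    (h_sub : LaplacianAddNonneg D u₂ (fun x => a * u₂ x ^ p - h x * f (u₂ x) + r x))
    (h_bdry : limsup (fun x => ((u₂ x - u₁ x : ℝ) : EReal)) (toBoundary D) ≤ 0) :
    ∀ x ∈ D, u₂ x ≤ u₁ x := by
  have hint : ∀ u, MemH1 D u → IntegrableOn u D := by
    intro u hu
    have : IsFiniteMeasure (volume.restrict (D : Set (EuclideanSpace ℝ (Fin N)))) :=
      isFiniteMeasure_restrict.2 hD_bdd.measure_lt_top.ne
    exact hu.1.integrable (by norm_num)
  have hholder : ∀ g, IsHolderOnClosure D α g → ContinuousOn g D := by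
    rintro g ⟨C, hC⟩
    exact (hC.continuousOn hα0).mono subset_closure
  have hFcont : ∀ u : EuclideanSpace ℝ (Fin N) → ℝ, ContinuousOn u D → (∀ x ∈ D, 0 < u x) →
      ContinuousOn (fun x => a * u x ^ p - h x * f (u x) + r x) D := by
    intro u hu hpos
    exact ((continuousOn_const.mul (hu.rpow_const fun x _ => Or.inr hp0.le)).sub
      ((hholder h hh).mul (hf_cont.comp hu fun x hx => (hpos x hx).le))).add (hholder r hr)
  refine le_of_laplacianAdd_of_limsup_le hN hD_bdd hp0 hp1 (hint u₁ hu₁) (hint u₂ hu₂) hu₁_cont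
    hu₂_cont hu₁_pos hu₂_pos (hFcont u₁ hu₁_cont hu₁_pos) (hFcont u₂ hu₂_cont hu₂_pos) ?_
    h_super h_sub h_bdry
  intro x hx hlt
  have h1 := hu₁_pos x hx
  have h2 := hu₂_pos x hx
  have hp₁ : 0 < u₁ x ^ p := Real.rpow_pos_of_pos h1 p
  have hp₂ : 0 < u₂ x ^ p := Real.rpow_pos_of_pos h2 p
  have hpow : u₁ x ^ p ≤ u₂ x ^ p := Real.rpow_le_rpow h1.le hlt.le hp0.le
  have hsub : Ioo (u₁ x) (u₂ x) ⊆ valueInterval D u₁ u₂ := by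
    intro t ht
    constructor
    · refine (iInf₂_le x hx).trans_lt ?_
      exact_mod_cast (min_le_left _ _).trans_lt ht.1
    · refine lt_of_lt_of_le ?_ (le_iSup₂ (f := fun y (_ : y ∈ D) =>
        ((max (u₁ y) (u₂ y) : ℝ) : EReal)) x hx)
      exact_mod_cast ht.2.trans_le (le_max_right _ _)
  -- The values `u₁ x`, `u₂ x` may be end points of the interval, where monotonicity is obtained
  -- by continuity.
  have hf : f (u₁ x) / u₁ x ^ p ≤ f (u₂ x) / u₂ x ^ p := by
    refine le_of_monotoneOn_Ioo_of_continuousOn_Icc (G := fun t => f t / t ^ p) hlt ?_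
      (hf_mono.mono hsub)
    refine (hf_cont.mono fun t ht => h1.le.trans ht.1).div
      (continuousOn_id.rpow_const fun t _ => Or.inr hp0.le) fun t ht => ?_
    exact (Real.rpow_pos_of_pos (h1.trans_le ht.1) p).ne'
  have e : ∀ s : ℝ, 0 < s → (a * s - h x * f (u₁ x) + r x) / s
      = a - h x * (f (u₁ x) / s) + r x / s := fun s hs => by field_simp
  have e' : ∀ s : ℝ, 0 < s → (a * s - h x * f (u₂ x) + r x) / s
      = a - h x * (f (u₂ x) / s) + r x / s := fun s hs => by field_simp
  rw [e _ hp₁, e' _ hp₂]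
  have hr' := div_le_div_of_nonneg_left (hr_nonneg x hx) hp₁ hpow
  have hh' := mul_le_mul_of_nonneg_left hf (hh_nonneg x hx)
  linarith
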